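/- Conventions. A set $B$ in a topological group $G$ is totally bounded if for every open neighbourhood $U$ of $1$ there is a finite $F\subset G$ with $B\subset FU\cap UF$; it is $\sigma$-bounded if it is a countable union of totally bounded sets. $G$ is $\omega$-bounded if for every neighbourhood $U$ of $1$ there is a countable $C\subset G$ with $G=C\cdot U$. A topological monoid (in particular, a finite power $G^k$ with the product topology) $X$ is a Menger monoid if for every sequence $\langle U_n:n\in\omega\rangle$ of open neighbourhoods of $1$ there are finite sets $F_n\subset X$ with $X=\bigcup_{n\in\omega}(F_nU_n\cap U_nF_n)$. All ultrafilters are nonprincipal ultrafilters on $\omega$. Ultrafilters $\mathcal L,\mathcal U$ are coherent if $\phi(\mathcal L)=\phi(\mathcal U)$ for some nondecreasing surjection $\phi:\omega\to\omega$; $\mathcal U$ is a $Q$-point if every nondecreasing surjection $\phi:\omega\to\omega$ is injective on some member of $\mathcal U$. $\mathfrak b(\mathcal L)$ is the cofinality of $(\omega^\omega,\le_{\mathcal L})$, where $x\le_{\mathcal L}y$ means $\{n:x(n)\le y(n)\}\in\mathcal L$. Finally, $\mathrm{cf}^*_g(G)$ is the minimal length $\lambda$ of an increasing chain $\langle G_i:i<\lambda\rangle$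 of proper subgroups of $G$ such that $G=\bigcup_{i<\lambda}G_i$ and every $\sigma$-bounded subset of $G$ is contained in some $G_i$. Theorem. Let $G$ be an $\omega$-bounded topological group such that some finite power $G^k$ is not a Menger monoid, and let $\mathcal L$ be an ultrafilter which is not coherent to any $Q$-point. Then $\mathrm{cf}^*_g(G)$ is well-defined (a chain as above exists) and $\mathrm{cf}^*_g(G)\le\mathfrak b(\mathcal L)$. -/

import Mathlib

open scoped Pointwise

universe u

section TopologicalMonoids

variable (M : Type u) [Monoid M] [TopologicalSpace M]

/-- A topological monoid `M` is a Menger monoid if for every sequence `U n` of open neighbourhoods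
of `1` there are finite sets `F n ⊆ M` with `M = ⋃ n, F n * U n ∩ U n * F n`. -/
def IsMengerMonoid : Prop :=
  ∀ U : ℕ → Set M, (∀ n, IsOpen (U n) ∧ (1 : M) ∈ U n) →
    ∃ F : ℕ → Set M, (∀ n, (F n).Finite) ∧
      (⋃ n, (F n * U n) ∩ (U n * F n)) = Set.univ

/-- A topological monoid `M` is `ω`-bounded if for every neighbourhood `U` of `1` there is a
countable set `C ⊆ M` with `M = C * U`. -/
def IsOmegaBounded : Prop :=
  ∀ U ∈ nhds (1 : M), ∃ C : Set M, C.Countable ∧ C * U = Set.univ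

variable {M}

/-- A subset `B` of a topological monoid is totally bounded if for every open neighbourhood `U` of
`1` there is a finite set `F` with `B ⊆ F * U ∩ U * F`. -/
def IsTotallyBoundedSubset (B : Set M) : Prop :=
  ∀ U : Set M, IsOpen U → (1 : M) ∈ U →
    ∃ F : Set M, F.Finite ∧ B ⊆ (F * U) ∩ (U * F)

/-- A subset of a topological monoid is `σ`-bounded if it is a countable union of totally bounded
subsets. -/
def IsSigmaBoundedSubset (H : Set M) : Prop :=
  ∃ B : ℕ → Set M, (∀ n, IsTotallyBoundedSubset (B n)) ∧ H = ⋃ n, B n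

end TopologicalMonoids

section Chains

variable (G : Type u) [Group G] [TopologicalSpace G]

/-- `X` is an increasing chain, indexed by the ordinals below `l`, of proper subgroups of `G` which
covers `G` and such that every `σ`-bounded subset of `G` is contained in a member of the chain. -/
structure IsSigmaBoundedChain {G : Type u} [Group G] [TopologicalSpace G] {l : Ordinal.{u}}
    (X : Set.Iio l → Subgroup G) : Prop where
  monotone : Monotone X
  proper : ∀ i, X i ≠ ⊤
  covers : (⋃ i, (X i : Set G)) = Set.univ
  swallows : ∀ H : Set G, IsSigmaBoundedSubset H → ∃ i, H ⊆ (X i : Set G)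

/-- The set of lengths of chains as in `IsSigmaBoundedChain`. -/
def sigmaBoundedChainLengths : Set Ordinal.{u} :=
  {l | ∃ X : Set.Iio l → Subgroup G, IsSigmaBoundedChain X}

/-- `cf*_g(G)`: the minimal length of a chain as in `IsSigmaBoundedChain`
(meaningful only if `sigmaBoundedChainLengths G` is nonempty). -/
noncomputable def cfStarGroup : Ordinal.{u} :=
  sInf (sigmaBoundedChainLengths G)

end Chains

section Ultrafilters

/-- An ultrafilter on `ℕ` is nonprincipal if it contains all cofinite sets. -/
def IsNonprincipal (L : Ultrafilter ℕ) : Prop :=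
  (L : Filter ℕ) ≤ Filter.cofinite

/-- Two ultrafilters on `ℕ` are (nearly) coherent if they have the same image under some
nondecreasing surjection `ℕ → ℕ`. -/
def IsCoherent (L L' : Ultrafilter ℕ) : Prop :=
  ∃ φ : ℕ → ℕ, Monotone φ ∧ Function.Surjective φ ∧ L.map φ = L'.map φ

/-- A `Q`-point is a nonprincipal ultrafilter on `ℕ` such that every nondecreasing surjection
`ℕ → ℕ` is injective on one of its members. -/
def IsQPoint (L : Ultrafilter ℕ) : Prop :=
  IsNonprincipal L ∧
    ∀ φ : ℕ → ℕ, Monotone φ → Function.Surjective φ → ∃ A ∈ L, Set.InjOn φ A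

/-- `𝔟(L)`: the cofinality of the set of functions `ℕ → ℕ`, linearly ordered modulo `L`. -/
noncomputable def ultrafilterB (L : Ultrafilter ℕ) : Cardinal.{0} :=
  Order.cof ((L : Filter ℕ).Germ ℕ)

end Ultrafilters

/-!
Along a suitable sequence of neighbourhoods `V n` of `1`, each with a countable family of translates
covering the `ω`-bounded group `G`, every element `x` of `G` has at each scale `n` a size: the least
`p` such that `x` and `x⁻¹` lie in the first `p + 1` translates, at the scales up to `n`
(`SizeLE`). Three facts about sizes are used.

* A totally bounded set has bounded size at each scale, and a `σ`-bounded set is bounded, modulo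
  every nonprincipal ultrafilter, by one function of the scale
  (`IsGrowthRelation.exists_bound_sigmaBounded`).
* The size of `x * y` at scale `n` is controlled by the sizes of `x` and `y` at scale `n + 1` and at
  a further scale depending on these (`IsGrowthRelation.mul`). The further scale is needed to move
  a neighbourhood past a translate by conjugation.
* Since a finite power of `G` is not Menger, the sizes of the elements of `G` have no common bound
  modulo `L` (`IsOmegaBounded.exists_isScaleSystem_unbounded`).

The obstacle is that elements bounded by a function `f` modulo `L` need not have products bounded in
terms of `f`, as the bound for the factors is known only at the scales in a member `A` of `L`,
whereas the product involves the sizes of the factors elsewhere. This is where coherence enters. As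
`L` is not coherent to a `Q`-point, no image of `L` under an interval partition is a `Q`-point,
which yields for each `f` a function `g` such that every member of `L` meets `[f n, g n]` for `L`-most
`n` (`exists_gap_bound`). Sizes increase with the scale, so a bound on `A` can be transported to the
scale `f n` at the cost of passing to a larger function that does not depend on the element. Hence
the subgroup generated by all elements below `f` modulo `L` lies below one function
(`IsGrowthRelation.exists_closure_bound`), and so is proper. Letting `f` run through the initial
segments of a sequence of length `𝔟(L)` cofinal modulo `L` gives the chain.
-/

/-! ### Monotone surjections of `ℕ` and the gap property -/

theorem tendsto_atTop_of_monotone_of_surjective {φ : ℕ → ℕ} (hm : Monotone φ)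
    (hs : Function.Surjective φ) : Filter.Tendsto φ Filter.atTop Filter.atTop :=
  Filter.tendsto_atTop_atTop_of_monotone hm fun b => (hs b).imp fun _ h => h.ge

/-- Every function can be outrun by the blocks of an interval partition: the partition is given as
the monotone surjection `φ` sending a number to the index of its block, and `f` never jumps over a
whole block. -/
theorem exists_monotone_surjective_le (f : ℕ → ℕ) :
    ∃ φ : ℕ → ℕ, Monotone φ ∧ Function.Surjective φ ∧ ∀ n n', φ n + 2 ≤ φ n' → f n ≤ n' := by
  -- `a j` is the left end point of the `j`-th block.
  obtain ⟨a, ha0, has⟩ : ∃ a : ℕ → ℕ, a 0 = 0 ∧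
      ∀ j, a (j + 1) = a j + 1 + (Finset.range (a j + 1)).sup f :=
    ⟨fun j => Nat.rec 0 (fun _ b => b + 1 + (Finset.range (b + 1)).sup f) j, rfl, fun _ => rfl⟩
  have hmono : StrictMono a := strictMono_nat_of_lt_succ fun j => by rw [has]; omega
  have haf : ∀ j n, n ≤ a j → f n ≤ a (j + 1) := by
    intro j n hn
    have : f n ≤ (Finset.range (a j + 1)).sup f :=
      Finset.le_sup (f := f) (Finset.mem_range.2 (by omega))
    rw [has]; omega
  let φ : ℕ → ℕ := fun n => Nat.findGreatest (fun j => a j ≤ n) n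
  have hle : ∀ n, a (φ n) ≤ n := fun n =>
    Nat.findGreatest_spec (P := fun j => a j ≤ n) (m := 0) (Nat.zero_le n)
      (ha0.trans_le (Nat.zero_le n))
  have hge : ∀ n j, a j ≤ n → j ≤ φ n := fun n j h =>
    Nat.le_findGreatest (P := fun j => a j ≤ n) ((hmono.id_le j).trans h) h
  refine ⟨φ, fun m n h => hge _ _ ((hle m).trans h), fun j => ⟨a j, ?_⟩, fun n n' h => ?_⟩
  · exact le_antisymm (hmono.le_iff_le.1 (hle (a j))) (hge _ _ le_rfl)
  · have h1 : n ≤ a (φ n + 1) := by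
      by_contra hc
      have := hge n (φ n + 1) (by omega)
      omega
    exact (haf _ _ h1).trans ((hmono.monotone h).trans (hle n'))

/-- An ultrafilter is coherent to its image under a monotone surjection `φ`. With `θ` an interval
partition whose blocks are long enough, `θ (φ n)` is `θ n` or `θ n - 1`; if the latter happens for
most `n`, joining the blocks in pairs, starting from one parity or the other, makes both equal. -/
theorem isCoherent_map {L : Ultrafilter ℕ} {φ : ℕ → ℕ} (hm : Monotone φ)
    (hs : Function.Surjective φ) : IsCoherent L (L.map φ) := by
  have hφle : ∀ n, φ n ≤ n := by
    intro n
    induction n with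
    | zero =>
      obtain ⟨k, hk⟩ := hs 0
      exact (hm (Nat.zero_le k)).trans hk.le
    | succ n ih =>
      -- A jump from `φ n` to at least `φ n + 2` would omit the value `φ n + 1`.
      by_contra hc
      obtain ⟨k, hk⟩ := hs (n + 1)
      rcases Nat.lt_or_ge n k with h | h
      · have := hm (show n + 1 ≤ k from h)
        omega
      · have := hm h
        omega
  choose N hN using fun j => hs (j + 1)
  have hfib : ∀ n, n ≤ N (φ n) := by
    intro n
    by_contra hc
    have := hm (not_le.1 hc).le
    rw [hN] at this
    omega
  obtain ⟨θ, hθm, hθs, hθ⟩ := exists_monotone_surjective_le fun j => N j + 1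
  have hnear : ∀ n, θ (φ n) = θ n ∨ θ (φ n) + 1 = θ n := by
    intro n
    have h1 := hθm (hφle n)
    have h2 : θ n < θ (φ n) + 2 := by
      by_contra hc
      have := hθ _ _ (not_lt.1 hc)
      have := hfib n
      omega
    omega
  have key : ∀ ψ : ℕ → ℕ, Monotone ψ → Function.Surjective ψ →
      (∀ᶠ n in L, ψ (θ (φ n)) = ψ (θ n)) → IsCoherent L (L.map φ) := by
    intro ψ hψm hψs h
    refine ⟨ψ ∘ θ, hψm.comp hθm, hψs.comp hθs, ?_⟩
    rw [Ultrafilter.map_map]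
    apply Ultrafilter.coe_injective
    rw [Ultrafilter.coe_map, Ultrafilter.coe_map]
    exact Filter.map_congr (h.mono fun n hn => hn.symm)
  have hall : ∀ᶠ n in (L : Filter ℕ), θ (φ n) = θ n ∨ (θ (φ n) + 1 = θ n ∧ θ n % 2 = 0) ∨
      (θ (φ n) + 1 = θ n ∧ θ n % 2 = 1) :=
    Filter.Eventually.of_forall fun n => by have := hnear n; omega
  rw [Ultrafilter.eventually_or, Ultrafilter.eventually_or] at hall
  rcases hall with h | h | h
  · exact key id monotone_id Function.surjective_id h
  · refine key (fun j => (j + 1) / 2) (fun i j hij => ?_) (fun j => ⟨2 * j, ?_⟩) (h.mono ?_)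
    · dsimp only; omega
    · dsimp only; omega
    · intro n hn; omega
  · refine key (fun j => j / 2) (fun i j hij => ?_) (fun j => ⟨2 * j, ?_⟩) (h.mono ?_)
    · dsimp only; omega
    · dsimp only; omega
    · intro n hn; omega

/-- The gap property of an ultrafilter `L` that is not coherent to a `Q`-point: to every `f` there
is `g` such that each member of `L` meets `[f n, g n]` for `L`-most `n`. If `f` had no such `g`, the
image of `L` under an interval partition outrunning `f` would be a `Q`-point. -/
theorem exists_gap_bound {L : Ultrafilter ℕ} (hL : IsNonprincipal L)
    (hQ : ∀ Q : Ultrafilter ℕ, IsQPoint Q → ¬ IsCoherent L Q) (f : ℕ → ℕ) :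
    ∃ g : ℕ → ℕ, ∀ A ∈ L, ∀ᶠ n in L, ∃ a ∈ A, f n ≤ a ∧ a ≤ g n := by
  by_contra! hcon
  obtain ⟨φ, hφm, hφs, hφ⟩ := exists_monotone_surjective_le f
  refine hQ (L.map φ) ⟨?_, fun ψ hψm hψs => ?_⟩ (isCoherent_map hφm hφs)
  · unfold IsNonprincipal at hL ⊢
    rw [Nat.cofinite_eq_atTop] at hL ⊢
    exact (tendsto_atTop_of_monotone_of_surjective hφm hφs).mono_left hL
  · -- `g n` lies beyond the end of the `ψ ∘ φ`-block of `n`.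
    choose g hg using fun n => (hψs.comp hφs) (ψ (φ n) + 1)
    obtain ⟨A, hA, hn⟩ := hcon g
    have hB : {n | n ∈ A ∧ ∀ a ∈ A, f n ≤ a → g n < a} ∈ L := by
      filter_upwards [hA, hn] with n h1 h2
      exact ⟨h1, h2⟩
    set B := {n | n ∈ A ∧ ∀ a ∈ A, f n ≤ a → g n < a}
    -- Any two points of `φ '' B` in a block of `ψ` are neighbours, so `ψ` is injective on each of
    -- the two parity classes of `φ '' B`.
    have hinj : ∀ r, Set.InjOn ψ (φ '' {n | n ∈ B ∧ φ n % 2 = r}) := by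
      intro r
      have hlt : ∀ n n', n ∈ B → n' ∈ B → φ n % 2 = φ n' % 2 → ψ (φ n) = ψ (φ n') →
          ¬ φ n < φ n' := by
        intro n n' hnB hnB' hr he hlt
        have h1 := hnB.2 n' hnB'.1 (hφ n n' (by omega))
        have h2 := hψm (hφm h1.le)
        have h3 := hg n
        simp only [Function.comp] at h3
        omega
      rintro _ ⟨n, ⟨hnB, hnr⟩, rfl⟩ _ ⟨n', ⟨hnB', hnr'⟩, rfl⟩ he
      exact le_antisymm (not_lt.1 (hlt _ _ hnB' hnB (by omega) he.symm))
        (not_lt.1 (hlt _ _ hnB hnB' (by omega) he))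
    have hpar : ∀ᶠ n in (L : Filter ℕ), (n ∈ B ∧ φ n % 2 = 0) ∨ (n ∈ B ∧ φ n % 2 = 1) := by
      filter_upwards [hB] with n h
      have : φ n % 2 = 0 ∨ φ n % 2 = 1 := by omega
      tauto
    rw [Ultrafilter.eventually_or] at hpar
    rcases hpar with h | h
    · exact ⟨_, Filter.image_mem_map h, hinj 0⟩
    · exact ⟨_, Filter.image_mem_map h, hinj 1⟩

/-! ### Well-ordered cofinal sequences -/

/-- A linear order `α` without maximum has a cofinal sequence of length `cof α` all of whose proper
initial segments are bounded. -/
theorem exists_cofinal_sequence {α : Type} [LinearOrder α] [Nonempty α] [NoMaxOrder α] :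
    ∃ s : Set.Iio (Cardinal.lift.{u} (Order.cof α)).ord → α,
      (∀ a, ∃ i, a ≤ s i) ∧ ∀ i, ∃ b, ∀ j ≤ i, s j ≤ b := by
  obtain ⟨S, hS, hcard⟩ := Order.exists_cof_eq (α := α)
  have hinf : Cardinal.aleph0 ≤ Cardinal.lift.{u} (Order.cof α) := by
    rw [Cardinal.aleph0_le_lift]; exact Order.aleph0_le_cof
  have hequiv : Nonempty (Set.Iio (Cardinal.lift.{u} (Order.cof α)).ord ≃ S) := by
    rw [← Cardinal.lift_mk_eq', Cardinal.mk_Iio_ordinal, Cardinal.card_ord, hcard]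
    simp
  obtain ⟨E⟩ := hequiv
  refine ⟨fun i => E i, fun a => ?_, fun i => ?_⟩
  · obtain ⟨b, hb, hab⟩ := hS a
    exact ⟨E.symm ⟨b, hb⟩, by simpa using hab⟩
  · by_contra! hcon
    have hcof : IsCofinal ((fun j => (E j : α)) '' Set.Iic i) := fun a => by
      obtain ⟨j, hj, hlt⟩ := hcon a
      exact ⟨_, ⟨j, hj, rfl⟩, hlt.le⟩
    have h1 := Cardinal.lift_le.{u + 1}.2 (Order.cof_le hcof)
    have h2 := h1.trans (Cardinal.mk_image_le_lift (f := fun j => (E j : α)) (s := Set.Iic i))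
    have h3 : Cardinal.mk (Set.Iic i) ≤ Cardinal.mk (Set.Iio (Order.succ i.1)) :=
      Cardinal.mk_le_of_injective
        (f := fun j : Set.Iic i =>
          (⟨j.1.1, Set.mem_Iio.2 (Order.lt_succ_of_le (show j.1.1 ≤ i.1 from j.2))⟩ :
            Set.Iio (Order.succ i.1)))
        fun j j' h => Subtype.ext (Subtype.ext (Subtype.mk.inj h))
    rw [Cardinal.mk_Iio_ordinal] at h3
    have h4 : (Order.succ i.1).card < Cardinal.lift.{u} (Order.cof α) :=
      Cardinal.lt_ord.1 ((Cardinal.isSuccLimit_ord hinf).succ_lt i.2)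
    have h5 := Cardinal.lift_lt.{u, u + 1}.2 h4
    have h6 := h2.trans (Cardinal.lift_le.2 h3)
    simp only [Cardinal.lift_lift] at h5 h6
    exact absurd (h5.trans_le (by simpa using h6)) (lt_irrefl _)

/-- `𝔟(L)` as the length of a sequence of functions cofinal modulo `L`, with bounded proper initial
segments. -/
theorem exists_cofinal_sequence_ultrafilter (L : Ultrafilter ℕ) :
    ∃ s : Set.Iio (Cardinal.lift.{u} (ultrafilterB L)).ord → ℕ → ℕ,
      (∀ f, ∃ i, f ≤ᶠ[L] s i) ∧ ∀ i, ∃ h, ∀ j ≤ i, s j ≤ᶠ[L] h := by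
  have : NoMaxOrder ((L : Filter ℕ).Germ ℕ) := ⟨fun x => by
    induction x using Filter.Germ.inductionOn with
    | h f =>
      exact ⟨((fun n => f n + 1 : ℕ → ℕ) : (L : Filter ℕ).Germ ℕ),
        Filter.Germ.coe_lt.2 (Filter.Eventually.of_forall fun n => Nat.lt_succ_self _)⟩⟩
  obtain ⟨s, hs, hb⟩ := exists_cofinal_sequence.{u} (α := (L : Filter ℕ).Germ ℕ)
  choose t ht using fun i => (s i).inductionOn
    (p := fun x => ∃ f : ℕ → ℕ, (f : Filter.Germ _ _) = x)
    fun f => ⟨f, rfl⟩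
  refine ⟨t, fun f => ?_, fun i => ?_⟩
  · obtain ⟨i, hi⟩ := hs f
    exact ⟨i, by rwa [← ht, Filter.Germ.coe_le] at hi⟩
  · obtain ⟨b, hb⟩ := hb i
    induction b using Filter.Germ.inductionOn with
    | h h => exact ⟨h, fun j hj => Filter.Germ.coe_le.1 ((ht j).symm ▸ hb j hj)⟩

/-! ### Growth relations on a group -/

/-- A relation `P x n p`, read "at scale `n` the element `x` has size at most `p`", which behaves
like the growth of elements of an `ω`-bounded group measured along a sequence of neighbourhoods of
`1`. The size of a product at scale `n` is controlled by the sizes of the factors at scale `n + 1`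
and at a finer scale `m`, which depends on the former sizes. -/
structure IsGrowthRelation {G : Type u} [Group G] [TopologicalSpace G] (P : G → ℕ → ℕ → Prop) :
    Prop where
  mono : ∀ {x n n' p p'}, P x n p → n' ≤ n → p ≤ p' → P x n' p'
  inv : ∀ {x n p}, P x n p → P x⁻¹ n p
  mul : ∀ n p, ∃ m, ∀ q, ∃ r, ∀ x y, P x (n + 1) p → P y (n + 1) p → P x m q → P y m q →
    P (x * y) n r
  bounded : ∀ B : Set G, IsTotallyBoundedSubset B → ∀ n, ∃ p, ∀ x ∈ B, P x n p

section Growth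

variable {G : Type u} [Group G] [TopologicalSpace G] {P : G → ℕ → ℕ → Prop} {L : Ultrafilter ℕ}

theorem isTotallyBoundedSubset_singleton (x : G) : IsTotallyBoundedSubset ({x} : Set G) := by
  intro U _ h1
  refine ⟨{x}, Set.finite_singleton x, ?_⟩
  rintro y rfl
  exact ⟨⟨y, rfl, 1, h1, mul_one y⟩, ⟨1, h1, y, rfl, one_mul y⟩⟩

theorem IsGrowthRelation.exists_size (hP : IsGrowthRelation P) (x : G) :
    ∃ f : ℕ → ℕ, ∀ n, P x n (f n) := by
  choose f hf using hP.bounded {x} (isTotallyBoundedSubset_singleton x)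
  exact ⟨f, fun n => hf n x rfl⟩

theorem IsGrowthRelation.exists_bound_sigmaBounded (hP : IsGrowthRelation P)
    (hL : IsNonprincipal L) {H : Set G} (hH : IsSigmaBoundedSubset H) :
    ∃ f : ℕ → ℕ, ∀ x ∈ H, ∀ᶠ n in L, P x n (f n) := by
  obtain ⟨B, hB, rfl⟩ := hH
  choose b hb using fun k => hP.bounded (B k) (hB k)
  refine ⟨fun n => (Finset.range (n + 1)).sup fun k => b k n, fun x hx => ?_⟩
  obtain ⟨k, hk⟩ := Set.mem_iUnion.1 hx
  unfold IsNonprincipal at hL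
  rw [Nat.cofinite_eq_atTop] at hL
  filter_upwards [hL (Filter.eventually_ge_atTop k)] with n hn
  exact hP.mono (hb k n x hk) le_rfl
    (Finset.le_sup (f := fun k => b k n) (Finset.mem_range.2 (Nat.lt_succ_of_le hn)))

/-- The gap property turns a bound for the sizes at `L`-most scales `n` into a bound for the sizes
at the scales `h n`: the member of `L` where the first bound holds has a point beyond `h n`, but not
far beyond. -/
theorem IsGrowthRelation.exists_shift (hP : IsGrowthRelation P)
    (hgap : ∀ f : ℕ → ℕ, ∃ g : ℕ → ℕ, ∀ A ∈ L, ∀ᶠ n in L, ∃ a ∈ A, f n ≤ a ∧ a ≤ g n)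
    (f h : ℕ → ℕ) :
    ∃ f' : ℕ → ℕ, ∀ x, (∀ᶠ n in L, P x n (f n)) → ∀ᶠ n in L, P x (h n) (f' n) := by
  obtain ⟨g, hg⟩ := hgap h
  refine ⟨fun n => (Finset.range (g n + 1)).sup f, fun x hx => ?_⟩
  filter_upwards [hg _ hx] with n ⟨a, ha, hn, hga⟩
  exact hP.mono ha hn (Finset.le_sup (f := f) (Finset.mem_range.2 (Nat.lt_succ_of_le hga)))

theorem IsGrowthRelation.exists_mul_bound (hP : IsGrowthRelation P)
    (hgap : ∀ f : ℕ → ℕ, ∃ g : ℕ → ℕ, ∀ A ∈ L, ∀ᶠ n in L, ∃ a ∈ A, f n ≤ a ∧ a ≤ g n)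
    (f : ℕ → ℕ) :
    ∃ f' : ℕ → ℕ, f ≤ f' ∧ ∀ x y, (∀ᶠ n in L, P x n (f n)) → (∀ᶠ n in L, P y n (f n)) →
      ∀ᶠ n in L, P (x * y) n (f' n) := by
  choose m r hr using hP.mul
  obtain ⟨p, hp⟩ := hP.exists_shift hgap f (fun n => n + 1)
  obtain ⟨q, hq⟩ := hP.exists_shift hgap f (fun n => m n (p n))
  refine ⟨fun n => max (f n) (r n (p n) (q n)), fun n => le_max_left _ _, fun x y hx hy => ?_⟩
  filter_upwards [hp x hx, hp y hy, hq x hx, hq y hy] with n h1 h2 h3 h4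
  exact hP.mono (hr n _ _ x y h1 h2 h3 h4) le_rfl (le_max_right _ _)

/-- The elements of a subgroup generated by elements that are uniformly bounded modulo `L` are
again uniformly bounded modulo `L`. -/
theorem IsGrowthRelation.exists_closure_bound (hP : IsGrowthRelation P) (hL : IsNonprincipal L)
    (hgap : ∀ f : ℕ → ℕ, ∃ g : ℕ → ℕ, ∀ A ∈ L, ∀ᶠ n in L, ∃ a ∈ A, f n ≤ a ∧ a ≤ g n)
    (f : ℕ → ℕ) :
    ∃ h : ℕ → ℕ, ∀ x ∈ Subgroup.closure {x : G | ∀ᶠ n in L, P x n (f n)},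
      ∀ᶠ n in L, P x n (h n) := by
  obtain ⟨f₁, hf₁⟩ := hP.exists_size 1
  choose next hle hmul using hP.exists_mul_bound hgap
  -- Words of length at most `2 ^ k` in the generators are bounded by `F k`.
  let F : ℕ → ℕ → ℕ := fun k => Nat.rec (f ⊔ f₁) (fun _ => next) k
  have hF0 : F 0 = f ⊔ f₁ := rfl
  have hFs : ∀ k, F (k + 1) = next (F k) := fun k => rfl
  have hFm : Monotone F := monotone_nat_of_le_succ fun k => hFs k ▸ hle (F k)
  have hmono : ∀ {x : G} {a b : ℕ → ℕ}, a ≤ b → (∀ᶠ n in L, P x n (a n)) →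
      ∀ᶠ n in L, P x n (b n) := fun hab hx => hx.mono fun n hn => hP.mono hn le_rfl (hab n)
  have hcl : ∀ x ∈ Subgroup.closure {x : G | ∀ᶠ n in L, P x n (f n)},
      ∃ k, ∀ᶠ n in L, P x n (F k n) := by
    intro x hx
    induction hx using Subgroup.closure_induction with
    | mem x hx => exact ⟨0, hmono (hF0 ▸ le_sup_left) hx⟩
    | one => exact ⟨0, hmono (hF0 ▸ le_sup_right) (Filter.Eventually.of_forall hf₁)⟩
    | mul x y _ _ hx hy =>
      obtain ⟨k, hk⟩ := hx
      obtain ⟨l, hl⟩ := hy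
      exact ⟨max k l + 1, hFs _ ▸ hmul _ x y (hmono (hFm (le_max_left k l)) hk)
        (hmono (hFm (le_max_right k l)) hl)⟩
    | inv x _ hx =>
      obtain ⟨k, hk⟩ := hx
      exact ⟨k, hk.mono fun n hn => hP.inv hn⟩
  refine ⟨fun n => F n n, fun x hx => ?_⟩
  obtain ⟨k, hk⟩ := hcl x hx
  unfold IsNonprincipal at hL
  rw [Nat.cofinite_eq_atTop] at hL
  filter_upwards [hk, hL (Filter.eventually_ge_atTop k)] with n h1 h2
  exact hP.mono h1 le_rfl (hFm h2 n)

/-- If no function bounds all elements of the group modulo `L`, then the subgroups generated by the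
elements below the members of a cofinal sequence form a chain. -/
theorem IsGrowthRelation.mem_sigmaBoundedChainLengths (hP : IsGrowthRelation P)
    (hL : IsNonprincipal L)
    (hgap : ∀ f : ℕ → ℕ, ∃ g : ℕ → ℕ, ∀ A ∈ L, ∀ᶠ n in L, ∃ a ∈ A, f n ≤ a ∧ a ≤ g n)
    (hunb : ∀ h : ℕ → ℕ, ∃ x, ¬ ∀ᶠ n in L, P x n (h n)) :
    (Cardinal.lift.{u} (ultrafilterB L)).ord ∈ sigmaBoundedChainLengths G := by
  obtain ⟨s, hs, hb⟩ := exists_cofinal_sequence_ultrafilter.{u} L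
  have hmono : ∀ {x : G} {a b : ℕ → ℕ}, a ≤ᶠ[L] b → (∀ᶠ n in L, P x n (a n)) →
      ∀ᶠ n in L, P x n (b n) := fun hab hx => by
    filter_upwards [hab, hx] with n h1 h2 using hP.mono h2 le_rfl h1
  have hsw : ∀ H : Set G, IsSigmaBoundedSubset H → ∃ i, H ⊆
      (Subgroup.closure {x : G | ∃ j ≤ i, ∀ᶠ n in L, P x n (s j n)} : Set G) := by
    intro H hH
    obtain ⟨f, hf⟩ := hP.exists_bound_sigmaBounded hL hH
    obtain ⟨i, hi⟩ := hs f
    exact ⟨i, fun x hx => Subgroup.subset_closure ⟨i, le_rfl, hmono hi (hf x hx)⟩⟩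
  refine ⟨fun i => Subgroup.closure {x | ∃ j ≤ i, ∀ᶠ n in L, P x n (s j n)}, ?_, ?_, ?_, hsw⟩
  · exact fun i i' h => Subgroup.closure_mono fun x ⟨j, hj, hx⟩ => ⟨j, hj.trans h, hx⟩
  · intro i htop
    obtain ⟨b, hb⟩ := hb i
    obtain ⟨h, hh⟩ := hP.exists_closure_bound hL hgap b
    obtain ⟨x, hx⟩ := hunb h
    refine hx (hh x (Subgroup.closure_mono ?_ (htop ▸ Subgroup.mem_top x)))
    exact fun y ⟨j, hj, hy⟩ => hmono (hb j hj) hy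
  · refine Set.eq_univ_of_forall fun x => ?_
    obtain ⟨i, hi⟩ := hsw {x} ⟨fun _ => {x}, fun _ => isTotallyBoundedSubset_singleton x,
      (Set.iUnion_const _).symm⟩
    exact Set.mem_iUnion.2 ⟨i, hi rfl⟩

end Growth

/-! ### The growth relation of an `ω`-bounded group -/

/-- A sequence of neighbourhoods `V n` of `1` in a topological group together with enumerations
`e n` of countable sets whose translates of `H n` cover the group. The sets `H n` are cube roots of
the `V n`, and `V n` is so small that finitely many of the earlier `e k j` conjugate it into
`V k`. -/
structure IsScaleSystem {G : Type u} [Group G] [TopologicalSpace G] (V H : ℕ → Set G)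
    (e : ℕ → ℕ → G) : Prop where
  isOpen : ∀ n, IsOpen (V n)
  one_mem : ∀ n, 1 ∈ H n
  mul_mem : ∀ {n a b c}, a ∈ H n → b ∈ H n → c ∈ H n → a * b * c ∈ V n
  cover : ∀ n z, ∃ j, (e n j)⁻¹ * z ∈ H n
  subset : ∀ {k n}, k < n → V n ⊆ H k
  conj : ∀ {k n j v}, k < n → j ≤ n → v ∈ V n → (e k j)⁻¹ * v * e k j ∈ V k

/-- At scale `n` the element `x` has size at most `p`: both `x` and `x⁻¹` lie in one of the first
`p + 1` translates `e k j * V k`, for every `k ≤ n`. -/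
def SizeLE {G : Type u} [Group G] (V : ℕ → Set G) (e : ℕ → ℕ → G) (x : G) (n p : ℕ) : Prop :=
  ∀ k ≤ n, (∃ j ≤ p, (e k j)⁻¹ * x ∈ V k) ∧ ∃ j ≤ p, (e k j)⁻¹ * x⁻¹ ∈ V k

section Scale

variable {G : Type u} [Group G] [TopologicalSpace G] {V H : ℕ → Set G} {e : ℕ → ℕ → G}

theorem IsScaleSystem.exists_mul_bound (hV : IsScaleSystem V H e) (n p q : ℕ) :
    ∃ r, ∀ k ≤ n, ∀ x y : G, (∃ i ≤ q, (e (n + 2 + p) i)⁻¹ * x ∈ V (n + 2 + p)) →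
      (∃ j ≤ p, (e (k + 1) j)⁻¹ * y ∈ V (k + 1)) → ∃ l ≤ r, (e k l)⁻¹ * (x * y) ∈ V k := by
  choose loc hloc using hV.cover
  let T : Finset (ℕ × ℕ × ℕ) :=
    Finset.range (n + 1) ×ˢ Finset.range (q + 1) ×ˢ Finset.range (p + 1)
  let w : ℕ × ℕ × ℕ → ℕ := fun t => loc t.1 (e (n + 2 + p) t.2.1 * e (t.1 + 1) t.2.2)
  refine ⟨T.sup w, ?_⟩
  rintro k hk x y ⟨i, hi, hx⟩ ⟨j, hj, hy⟩
  refine ⟨w (k, i, j), Finset.le_sup (f := w) ?_, ?_⟩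
  · simp only [T, Finset.mem_product, Finset.mem_range]; omega
  · have h1 := hV.conj (k := k + 1) (j := j) (by omega) (by omega) hx
    have := hV.mul_mem (hloc k (e (n + 2 + p) i * e (k + 1) j)) (hV.subset (Nat.lt_succ_self k) h1)
      (hV.subset (Nat.lt_succ_self k) hy)
    have heq : (e k (w (k, i, j)))⁻¹ * (x * y) =
        (e k (loc k (e (n + 2 + p) i * e (k + 1) j)))⁻¹ * (e (n + 2 + p) i * e (k + 1) j) *
        ((e (k + 1) j)⁻¹ * ((e (n + 2 + p) i)⁻¹ * x) * e (k + 1) j) *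
        ((e (k + 1) j)⁻¹ * y) := by
      simp only [w]; group
    rwa [heq]

theorem IsScaleSystem.mul_mem' (hV : IsScaleSystem V H e) {n : ℕ} {a b : G} (ha : a ∈ H n)
    (hb : b ∈ H n) : a * b ∈ V n := by
  simpa using hV.mul_mem ha hb (hV.one_mem n)

theorem IsScaleSystem.one_mem' (hV : IsScaleSystem V H e) (n : ℕ) : 1 ∈ V n := by
  simpa using hV.mul_mem' (hV.one_mem n) (hV.one_mem n)

theorem IsScaleSystem.exists_bound [IsTopologicalGroup G] (hV : IsScaleSystem V H e) {B : Set G}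
    (hB : IsTotallyBoundedSubset B) (k : ℕ) :
    ∃ p, ∀ x ∈ B, (∃ j ≤ p, (e k j)⁻¹ * x ∈ V k) ∧ ∃ j ≤ p, (e k j)⁻¹ * x⁻¹ ∈ V k := by
  choose loc hloc using hV.cover
  obtain ⟨F, hF, hBF⟩ := hB (V (k + 1) ∩ (V (k + 1))⁻¹)
    ((hV.isOpen _).inter (hV.isOpen _).inv) ⟨hV.one_mem' _, by simpa using hV.one_mem' (k + 1)⟩
  have hsub := hV.subset (Nat.lt_succ_self k)
  let w : G → ℕ := fun z => max (loc k z) (loc k z⁻¹)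
  have hw : ∀ z ∈ F, w z ≤ hF.toFinset.sup w := fun z hz =>
    Finset.le_sup (f := w) (hF.mem_toFinset.2 hz)
  refine ⟨hF.toFinset.sup w, fun x hx => ⟨?_, ?_⟩⟩
  · obtain ⟨z, hz, u, hu, rfl⟩ := (hBF hx).1
    refine ⟨loc k z, (le_max_left _ _).trans (hw z hz), ?_⟩
    simpa only [mul_assoc] using hV.mul_mem' (hloc k z) (hsub hu.1)
  · obtain ⟨u, hu, z, hz, rfl⟩ := (hBF hx).2
    refine ⟨loc k z⁻¹, (le_max_right _ _).trans (hw z hz), ?_⟩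
    simpa only [mul_assoc, mul_inv_rev] using hV.mul_mem' (hloc k z⁻¹) (hsub hu.2)

theorem IsScaleSystem.isGrowthRelation [IsTopologicalGroup G] (hV : IsScaleSystem V H e) :
    IsGrowthRelation (SizeLE V e) where
  mono h hn hp k hk := by
    obtain ⟨⟨i, hi, hx⟩, ⟨j, hj, hy⟩⟩ := h k (hk.trans hn)
    exact ⟨⟨i, hi.trans hp, hx⟩, ⟨j, hj.trans hp, hy⟩⟩
  inv h k hk := ⟨(h k hk).2, by simpa using (h k hk).1⟩
  mul n p := by
    refine ⟨n + 2 + p, fun q => ?_⟩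
    obtain ⟨r, hr⟩ := hV.exists_mul_bound n p q
    refine ⟨r, fun x y hx hy hx' hy' k hk => ⟨hr k hk x y (hx' _ le_rfl).1 (hy _ (by omega)).1, ?_⟩⟩
    rw [mul_inv_rev]
    exact hr k hk _ _ (hy' _ le_rfl).2 (hx _ (by omega)).2
  bounded B hB n := by
    choose p hp using hV.exists_bound hB
    refine ⟨(Finset.range (n + 1)).sup p, fun x hx k hk => ?_⟩
    have hle : p k ≤ (Finset.range (n + 1)).sup p :=
      Finset.le_sup (f := p) (Finset.mem_range.2 (Nat.lt_succ_of_le hk))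
    obtain ⟨⟨i, hi, h1⟩, ⟨j, hj, h2⟩⟩ := hp k x hx
    exact ⟨⟨i, hi.trans hle, h1⟩, ⟨j, hj.trans hle, h2⟩⟩

end Scale

theorem IsOmegaBounded.exists_enumeration {G : Type u} [Group G] [TopologicalSpace G]
    (hG : IsOmegaBounded G) {U : Set G} (hU : U ∈ nhds 1) :
    ∃ e : ℕ → G, ∀ z, ∃ j, (e j)⁻¹ * z ∈ U := by
  obtain ⟨C, hC, hCU⟩ := hG U hU
  have hne : C.Nonempty := by
    obtain ⟨c, hc, _⟩ := hCU.symm ▸ Set.mem_univ (1 : G)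
    exact ⟨c, hc⟩
  obtain ⟨e, rfl⟩ := hC.exists_eq_range hne
  refine ⟨e, fun z => ?_⟩
  obtain ⟨_, ⟨j, rfl⟩, u, hu, rfl⟩ := hCU.symm ▸ Set.mem_univ z
  exact ⟨j, by simpa using hu⟩

/-- In an `ω`-bounded group there are scale systems subordinate to any given sequence of
neighbourhoods of `1`. -/
theorem IsOmegaBounded.exists_isScaleSystem {G : Type u} [Group G] [TopologicalSpace G]
    [IsTopologicalGroup G] (hG : IsOmegaBounded G) {W : ℕ → Set G} (hW : ∀ n, W n ∈ nhds 1) :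
    ∃ V H e, IsScaleSystem (G := G) V H e ∧ ∀ n, V n ⊆ W n := by
  have hroot : ∀ U : Set G, ∃ K : Set G, U ∈ nhds 1 → K ∈ nhds 1 ∧
      ∀ {a b c}, a ∈ K → b ∈ K → c ∈ K → a * b * c ∈ U := by
    intro U
    by_cases hU : U ∈ nhds 1
    · obtain ⟨K, hK, hKU⟩ := exists_nhds_one_split4 hU
      exact ⟨K, fun _ => ⟨hK, fun ha hb hc => by
        simpa using hKU ha hb hc (mem_of_mem_nhds hK)⟩⟩
    · exact ⟨∅, fun h => absurd h hU⟩
  choose K hK using hroot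
  have henum : ∀ U : Set G, ∃ e : ℕ → G, U ∈ nhds 1 → ∀ z, ∃ j, (e j)⁻¹ * z ∈ K U := by
    intro U
    by_cases hU : U ∈ nhds 1
    · obtain ⟨e, he⟩ := hG.exists_enumeration (hK U hU).1
      exact ⟨e, fun _ => he⟩
    · exact ⟨1, fun h => absurd h hU⟩
  choose e he using henum
  -- The recursion carries the index along, as the first component of a pair: it decides how many
  -- conjugates and how many of the `W k` are taken into account.
  obtain ⟨s, hs, hr⟩ := exists_seq_of_forall_finset_exists
    (fun a : ℕ × Set G => (IsOpen a.2 ∧ 1 ∈ a.2) ∧ ∀ k ≤ a.1, a.2 ⊆ W k)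
    (fun a b => a.1 < b.1 ∧ b.2 ⊆ K a.2 ∧
      ∀ j ≤ b.1, ∀ v ∈ b.2, (e a.2 j)⁻¹ * v * e a.2 j ∈ a.2) (by
    intro S hS
    let N := S.sup Prod.fst + 1
    have hmem : ((⋂ k ∈ Set.Iic N, W k) ∩ ⋂ a ∈ S, (K a.2 ∩ ⋂ j ∈ Set.Iic N,
        {v | (e a.2 j)⁻¹ * v * e a.2 j ∈ a.2})) ∈ nhds (1 : G) := by
      refine Filter.inter_mem ((Filter.biInter_mem (Set.finite_Iic N)).2 fun k _ => hW k)
        ((Filter.biInter_finset_mem S).2 fun a ha => ?_)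
      have ha2 : a.2 ∈ nhds (1 : G) := (hS a ha).1.1.mem_nhds (hS a ha).1.2
      refine Filter.inter_mem (hK _ ha2).1
        ((Filter.biInter_mem (Set.finite_Iic N)).2 fun j _ => ?_)
      have hc : Continuous fun v : G => (e a.2 j)⁻¹ * v * e a.2 j := by fun_prop
      exact hc.continuousAt.preimage_mem_nhds (by simpa using ha2)
    obtain ⟨V, hVsub, hVo, hV1⟩ := mem_nhds_iff.1 hmem
    refine ⟨(N, V), ⟨⟨hVo, hV1⟩, fun k hk v hv => ?_⟩, fun a ha => ⟨?_, fun v hv => ?_, ?_⟩⟩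
    · exact Set.mem_iInter₂.1 (hVsub hv).1 k hk
    · exact Nat.lt_succ_of_le (Finset.le_sup (f := Prod.fst) ha)
    · exact (Set.mem_iInter₂.1 (hVsub hv).2 a ha).1
    · intro j hj v hv
      exact Set.mem_iInter₂.1 (Set.mem_iInter₂.1 (hVsub hv).2 a ha).2 j hj)
  have hidx : ∀ n, n ≤ (s n).1 :=
    (strictMono_nat_of_lt_succ fun n => (hr n (n + 1) n.lt_succ_self).1).id_le
  have hnhds : ∀ n, (s n).2 ∈ nhds (1 : G) := fun n => (hs n).1.1.mem_nhds (hs n).1.2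
  refine ⟨fun n => (s n).2, fun n => K (s n).2, fun n => e (s n).2,
    ⟨fun n => (hs n).1.1, fun n => mem_of_mem_nhds (hK _ (hnhds n)).1,
      fun {n} _ _ _ => (hK _ (hnhds n)).2, fun n => he _ (hnhds n),
      fun h => (hr _ _ h).2.1, fun h hj hv => (hr _ _ h).2.2 _ (hj.trans (hidx _)) _ hv⟩,
    fun n => (hs n).2 n (hidx n)⟩

/-- If a finite power of `G` is not Menger, then, along a suitable scale system, no function bounds
the sizes of all elements of `G` modulo any ultrafilter: otherwise the points of `G ^ k` with
coordinates of size at most `h n` at scale `n` would be covered by finitely many translates, and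
each point is of this kind for some `n`, since an ultrafilter is closed under finite
intersections. -/
theorem IsOmegaBounded.exists_isScaleSystem_unbounded {G : Type u} [Group G] [TopologicalSpace G]
    [IsTopologicalGroup G] (hG : IsOmegaBounded G) {k : ℕ} (hk : ¬ IsMengerMonoid (Fin k → G)) :
    ∃ V H e, IsScaleSystem (G := G) V H e ∧ ∀ (L : Ultrafilter ℕ) (h : ℕ → ℕ),
      ∃ x, ¬ ∀ᶠ n in L, SizeLE V e x n (h n) := by
  unfold IsMengerMonoid at hk
  push Not at hk
  obtain ⟨U, hU, hbad⟩ := hk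
  have hbox : ∀ n, ∃ W : Set G, W ∈ nhds 1 ∧ ∀ w : Fin k → G, (∀ i, w i ∈ W) → w ∈ U n := by
    intro n
    have h1 := (hU n).1.mem_nhds (hU n).2
    rw [nhds_pi, Filter.mem_pi'] at h1
    obtain ⟨I, t, ht, hsub⟩ := h1
    exact ⟨⋂ i, t i, Filter.iInter_mem.2 ht,
      fun w hw => hsub fun i _ => Set.mem_iInter.1 (hw i) i⟩
  choose W hW hWU using hbox
  obtain ⟨V, H, e, hV, hVW⟩ := hG.exists_isScaleSystem
    (W := fun n => W n ∩ (W n)⁻¹) fun n => Filter.inter_mem (hW n) (inv_mem_nhds_one G (hW n))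
  refine ⟨V, H, e, hV, fun L h => ?_⟩
  by_contra! hall
  let D : ℕ → Set G := fun n => e n '' Set.Iic (h n) ∪ (e n '' Set.Iic (h n))⁻¹
  have hD : ∀ n, (D n).Finite := fun n =>
    ((Set.finite_Iic (h n)).image (e n)).union ((Set.finite_Iic (h n)).image (e n)).inv
  refine hbad (fun n => Set.univ.pi fun _ => D n) (fun n => Set.Finite.pi fun _ => hD n)
    (Set.eq_univ_of_forall fun x => ?_)
  obtain ⟨n, hn⟩ := (Filter.eventually_all.2 fun i => hall (x i)).exists
  choose c hc hxc using fun i => (hn i n le_rfl).1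
  choose d hd hxd using fun i => (hn i n le_rfl).2
  refine Set.mem_iUnion.2 ⟨n, ⟨fun i => e n (c i), ?_, fun i => (e n (c i))⁻¹ * x i, ?_, ?_⟩,
    ⟨fun i => x i * e n (d i), ?_, fun i => (e n (d i))⁻¹, ?_, ?_⟩⟩
  · exact fun i _ => Or.inl ⟨c i, hc i, rfl⟩
  · exact hWU n _ fun i => (hVW n (hxc i)).1
  · funext i; simp
  · exact hWU n _ fun i => by simpa using (hVW n (hxd i)).2
  · exact fun i _ => Or.inr (Set.inv_mem_inv.2 ⟨d i, hd i, rfl⟩)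
  · funext i; simp

/-! ### The length of the chains -/

theorem theorem2 (G : Type u) [Group G] [TopologicalSpace G] [IsTopologicalGroup G]
    (hG : IsOmegaBounded G)
    (hM : ∃ k : ℕ, ¬ IsMengerMonoid (Fin k → G))
    (L : Ultrafilter ℕ) (hL : IsNonprincipal L)
    (hQ : ∀ Q : Ultrafilter ℕ, IsQPoint Q → ¬ IsCoherent L Q) :
    (sigmaBoundedChainLengths G).Nonempty ∧
      cfStarGroup G ≤ (Cardinal.lift.{u} (ultrafilterB L)).ord := by
  obtain ⟨k, hk⟩ := hM
  obtain ⟨V, H, e, hV, hunb⟩ := hG.exists_isScaleSystem_unbounded hk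
  have hmem := hV.isGrowthRelation.mem_sigmaBoundedChainLengths hL
    (fun f => exists_gap_bound hL hQ f) (hunb L)
  exact ⟨⟨_, hmem⟩, csInf_le' hmem⟩
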